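/- Let $N$ be a non-negative integer, let $\mu\in\mathbb R$ and $\sigma>0$, and fix real numbers $a_1>a_2>\cdots>a_N$. Write ${\rm N}[m,s]$ for the real Gaussian law with mean $m$ and standard deviation $s$. Consider the random $(N+1)\times(N+1)$ Hermitian matrix $$\begin{bmatrix} c_N & \vec v_N^{\,\dagger}\\ \vec v_N & {\rm diag}\,[a_1,\dots,a_N]\end{bmatrix},$$ where $c_N$ has law ${\rm N}[\mu,\sigma/\sqrt2]$, the $N$ components of $\vec v_N$ are independent complex Gaussians with law ${\rm N}[0,\sigma/2]+i\,{\rm N}[0,\sigma/2]$ (independent real and imaginary parts), and $c_N$ is independent of $\vec v_N$. Then the vector $\lambda=(\lambda_1,\dots,\lambda_{N+1})$ of its eigenvalues, listed in decreasing order, has the probability density function (with respect to Lebesgue measure on $\mathbb R^{N+1}$) $$\Big(\frac{\sqrt2}{\sigma}\Big)^{2N+1}\sqrt{\frac1{2\pi}}\; e^{-\sigma^{-2}\left(\sum_{j=1}^{N+1}\lambda_j^2-\sum_{j=1}^N a_j^2\right)}\, e^{-(\mu/\sigma)^2}\, e^{2\mu\sigma^{-2}\left(\sum_{j=1}^{N+1}\lambda_j-\sum_{j=1}^N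 a_j\right)}\, \frac{\prod_{1\le j<k\le N+1}(\lambda_j-\lambda_k)}{\prod_{1\le j<k\le N}(a_j-a_k)}\;\chi(\lambda\succ a),$$ where $\chi(\lambda\succ a)$ is the indicator function of the region $\lambda_1>a_1>\lambda_2>a_2>\cdots>a_N>\lambda_{N+1}$. -/

import Mathlib

noncomputable section

/-- The real Gaussian law `N[m, s]` with mean `m` and standard deviation `s`. -/
def realNormal (m s : ℝ) : MeasureTheory.Measure ℝ :=
  ProbabilityTheory.gaussianReal m (s ^ 2).toNNReal

/-- The law of `N[0, s] + i N[0, s]` (independent real and imaginary parts). -/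
def complexNormal (s : ℝ) : MeasureTheory.Measure ℂ :=
  ((realNormal 0 s).prod (realNormal 0 s)).map (fun p : ℝ × ℝ => (⟨p.1, p.2⟩ : ℂ))

/-- The bordered matrix `[[c, v†], [v, diag a]]`. -/
def borderedMatrix {N : ℕ} (a : Fin N → ℝ) (c : ℝ) (v : Fin N → ℂ) :
    Matrix (Unit ⊕ Fin N) (Unit ⊕ Fin N) ℂ :=
  Matrix.fromBlocks
    (Matrix.of fun _ _ => (c : ℂ))
    (Matrix.of fun _ j => star (v j))
    (Matrix.of fun j _ => v j)
    (Matrix.diagonal fun j => (a j : ℂ))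

theorem borderedMatrix_isHermitian {N : ℕ} (a : Fin N → ℝ) (c : ℝ) (v : Fin N → ℂ) :
    (borderedMatrix a c v).IsHermitian := by
  unfold borderedMatrix
  refine Matrix.IsHermitian.fromBlocks ?_ ?_ ?_
  · ext i j
    simp [Matrix.conjTranspose_apply]
  · ext i j
    simp [Matrix.conjTranspose_apply]
  · refine Matrix.isHermitian_diagonal_of_self_adjoint _ ?_
    ext i
    simp

/-- The eigenvalues of the bordered matrix, with multiplicity, listed in decreasing order. -/
def borderedEigenvalues {N : ℕ} (a : Fin N → ℝ) (c : ℝ) (v : Fin N → ℂ) :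
    Fin (N + 1) → ℝ :=
  fun j => (borderedMatrix_isHermitian a c v).eigenvalues₀
    (Fin.cast (by simp [add_comm]) j)

/-- The interlacing `l₁ > a₁ > l₂ > a₂ > ⋯ > a_N > l_{N+1}`. -/
def Interlaces {N : ℕ} (l : Fin (N + 1) → ℝ) (a : Fin N → ℝ) : Prop :=
  ∀ j : Fin N, a j < l j.castSucc ∧ l j.succ < a j

/-- The product `∏_{j < k} (x_j - x_k)`. -/
def vandermondeProd {n : ℕ} (x : Fin n → ℝ) : ℝ :=
  ∏ j : Fin n, ∏ k ∈ Finset.Ioi j, (x j - x k)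

/-- The density of the ordered eigenvalues of the bordered matrix. -/
def borderedDensity {N : ℕ} (μ σ : ℝ) (a : Fin N → ℝ) : (Fin (N + 1) → ℝ) → ℝ :=
  Set.indicator {l | Interlaces l a} fun l =>
    (√2 / σ) ^ (2 * N + 1) * √(1 / (2 * Real.pi))
      * Real.exp (-(σ ^ 2)⁻¹ * (∑ j, l j ^ 2 - ∑ j, a j ^ 2))
      * Real.exp (-(μ / σ) ^ 2)
      * Real.exp (2 * μ * (σ ^ 2)⁻¹ * (∑ j, l j - ∑ j, a j))
      * (vandermondeProd l / vandermondeProd a)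

end

/-!
The bordered matrix has a spectrum which depends on `c` and on the squared moduli `w_j = |v_j|²`
only, and the proof is a change of variables between the spectrum `l` and the vector `(c, w)`.

By the Schur complement formula, the characteristic polynomial takes the value
`-w_j ∏_{k ≠ j} (a_j - a_k)` at the node `a_j` (`eval_charpoly_borderedMatrix_node`), and the trace
gives `c = ∑ l_k - ∑ a_j`. Hence `(c, w)` is an explicit polynomial function `borderData a l` of
the spectrum (`borderData_borderedEigenvalues`). If no `v_j` vanishes, which is almost
surely the case, the signs of the characteristic polynomial at the nodes alternate, and
counting the eigenvalues above each node forces the strict interlacing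
(`interlaces_of_prod_sub_eq`). On the interlacing region `borderData a` is injective, because
two monic polynomials of degree `N + 1` with the same subleading coefficient and the same values
at `N` nodes coincide (`injOn_borderData`).

The Jacobian determinant of `borderData a` is the quotient of the Vandermonde products of `l` and
`a` up to sign: Lagrange interpolation at the `l_k` shows that the Jacobian matrix times the
Vandermonde matrix of `l` is, up to diagonal factors, the Vandermonde matrix of `a` bordered by a
unit vector (`borderJacobian_mul_vandermonde`, `abs_det_borderJacobian`).

The entry `c` is Gaussian and the `w_j` are independent exponential variables of rate `2 / σ²`
(`hasLaw_normSq_complexNormal`), so the density of `(c, w)` is explicit (`hasLaw_corner_normSq`).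
Pulling it back along `borderData a` gives the law of the spectrum
(`hasLaw_of_injOn_of_hasFDerivWithinAt`), and the identity `∑ l_k² = c² + 2 ∑ w_j + ∑ a_j²`
(`sum_sq_eq_borderData`) brings the exponent into the stated form.
-/

/-! ### The corner entry and squared moduli of a spectrum -/

section BorderData

open Finset

/-- The product `∏_{k ≠ j} (a_j - a_k)` of the differences of a node to all the others. -/
noncomputable def nodeProd {n : ℕ} (a : Fin n → ℝ) (j : Fin n) : ℝ :=
  ∏ k ∈ univ.erase j, (a j - a k)

/-- The map sending a spectrum `l` to the pair `(c, w)` of a corner entry `c = ∑ l - ∑ a` and of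
squared moduli `w_j = -∏_k (a_j - l_k) / ∏_{k ≠ j} (a_j - a_k)` which a bordered matrix with
spectrum `l` must have. The pair is encoded as a vector whose first coordinate is `c`. -/
noncomputable def borderData {N : ℕ} (a : Fin N → ℝ) (l : Fin (N + 1) → ℝ) : Fin (N + 1) → ℝ :=
  Fin.cons (∑ k, l k - ∑ j, a j) fun j => -(∏ k, (a j - l k)) / nodeProd a j

end BorderData

/-! ### Vandermonde products -/

section Vandermonde

open Finset Polynomial

theorem nodeProd_ne_zero {n : ℕ} {a : Fin n → ℝ} (ha : Function.Injective a) (j : Fin n) :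
    nodeProd a j ≠ 0 :=
  prod_ne_zero_iff.2 fun _ hk => sub_ne_zero.2 fun h => (mem_erase.1 hk).1 (ha h).symm

theorem vandermondeProd_pos {n : ℕ} {x : Fin n → ℝ} (hx : StrictAnti x) :
    0 < vandermondeProd x :=
  prod_pos fun _ _ => prod_pos fun _ hk => sub_pos.2 (hx (mem_Ioi.1 hk))

theorem abs_det_vandermonde {n : ℕ} (x : Fin n → ℝ) :
    |(Matrix.vandermonde x).det| = |vandermondeProd x| := by
  rw [Matrix.det_vandermonde, vandermondeProd]
  simp only [abs_prod]
  exact prod_congr rfl fun i _ => prod_congr rfl fun j _ => abs_sub_comm _ _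

theorem abs_prod_nodeProd {n : ℕ} (x : Fin n → ℝ) :
    |∏ i, nodeProd x i| = |vandermondeProd x| ^ 2 := by
  have h : ∀ i : Fin n, nodeProd x i = (∏ k ∈ Iio i, (x i - x k)) * ∏ k ∈ Ioi i, (x i - x k) := by
    intro i
    rw [nodeProd, ← prod_union]
    · congr 1
      ext k
      simp [lt_or_lt_iff_ne]
    · exact disjoint_left.2 fun k h1 h2 => lt_asymm (mem_Iio.1 h1) (mem_Ioi.1 h2)
  have h' : ∏ i, ∏ k ∈ Iio i, |x i - x k| = ∏ i, ∏ k ∈ Ioi i, |x i - x k| := by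
    rw [prod_comm' (t' := univ) (s' := fun k => Ioi k) (by simp)]
    exact prod_congr rfl fun i _ => prod_congr rfl fun j _ => abs_sub_comm _ _
  simp only [h, prod_mul_distrib, vandermondeProd, abs_mul, abs_prod, h', sq]

end Vandermonde

/-! ### The interlacing region -/

section Interlacing

open Finset Polynomial

variable {N : ℕ} {a : Fin N → ℝ} {l l' : Fin (N + 1) → ℝ}

theorem Interlaces.strictAnti (h : Interlaces l a) : StrictAnti l :=
  Fin.strictAnti_iff_succ_lt.2 fun j => (h j).2.trans (h j).1

/-- On the interlacing region the squared moduli are positive: apart from the two spectral points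
adjacent to `a_j`, the points `l_k` can be matched with the nodes `a_k`, `k ≠ j`, each on the same
side of `a_j` as its partner. -/
theorem borderData_succ_pos (ha : StrictAnti a) (h : Interlaces l a) (j : Fin N) :
    0 < borderData a l j.succ := by
  have hj : 0 < -((a j - l j.castSucc) * (a j - l j.succ)) := by
    rw [← neg_mul]
    exact mul_pos (by linarith [(h j).1]) (by linarith [(h j).2])
  have hs : j.castSucc.succAbove j = j.succ := Fin.succAbove_castSucc_self j
  have hq : 0 < ∏ i ∈ univ.erase j, ((a j - l (j.castSucc.succAbove i)) / (a j - a i)) := by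
    refine prod_pos fun i hi => ?_
    rcases lt_or_gt_of_ne (mem_erase.1 hi).1 with hij | hij
    · rw [Fin.succAbove_castSucc_of_lt _ _ hij]
      exact div_pos_of_neg_of_neg (by linarith [ha hij, (h i).1]) (by linarith [ha hij])
    · rw [Fin.succAbove_castSucc_of_le _ _ hij.le]
      exact div_pos (by linarith [ha hij, (h i).2]) (by linarith [ha hij])
  have := mul_pos hj hq
  rw [prod_div_distrib, ← mul_div_assoc, neg_mul, mul_assoc] at this
  simpa only [borderData, Fin.cons_succ, nodeProd, Fin.prod_univ_succAbove _ j.castSucc,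
    ← mul_prod_erase univ (fun i => a j - l (j.castSucc.succAbove i)) (mem_univ j), hs] using this

theorem measurableSet_interlaces : MeasurableSet {l : Fin (N + 1) → ℝ | Interlaces l a} := by
  simp only [Interlaces, Set.ofPred_forall]
  refine MeasurableSet.iInter fun j => ?_
  exact (measurableSet_lt measurable_const (measurable_pi_apply _)).inter
    (measurableSet_lt (measurable_pi_apply _) measurable_const)

end Interlacing

/-! ### Monic polynomials with prescribed roots -/

section Nodal

open Finset Polynomial

theorem degree_nodal_sub_nodal_lt {N : ℕ} {x y : Fin (N + 1) → ℝ} (h : ∑ k, x k = ∑ k, y k) :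
    (Lagrange.nodal univ x - Lagrange.nodal univ y).degree < N := by
  have hd : ∀ z : Fin (N + 1) → ℝ, (Lagrange.nodal univ z).degree = (N + 1 : ℕ) := fun z => by
    simp
  have hlt : (Lagrange.nodal univ x - Lagrange.nodal univ y).degree < (N + 1 : ℕ) := by
    rw [← hd x]
    refine degree_sub_lt_left ((hd x).trans (hd y).symm) Lagrange.nodal_ne_zero ?_
    rw [Lagrange.nodal_monic.leadingCoeff, Lagrange.nodal_monic.leadingCoeff]
  have hc : ∀ z : Fin (N + 1) → ℝ, (Lagrange.nodal univ z).coeff N = -∑ k, z k := fun z => by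
    simpa [Lagrange.nodal] using prod_X_sub_C_coeff_card_pred univ z (by simp)
  rw [degree_lt_iff_coeff_zero] at hlt ⊢
  intro m hm
  rcases hm.eq_or_lt with rfl | hm
  · rw [coeff_sub, hc, hc, h, sub_self]
  · exact hlt m hm

theorem two_mul_coeff_nodal {ι : Type*} [DecidableEq ι] (s : Finset ι) (x : ι → ℝ) (m : ℕ)
    (hm : m + 2 = #s) :
    2 * (Lagrange.nodal s x).coeff m = (∑ i ∈ s, x i) ^ 2 - ∑ i ∈ s, x i ^ 2 := by
  induction s using Finset.induction_on generalizing m with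
  | empty => simp at hm
  | insert i s hi ih =>
    rw [card_insert_of_notMem hi] at hm
    have hc : (Lagrange.nodal s x).coeff m = -∑ k ∈ s, x k := by
      have := prod_X_sub_C_coeff_card_pred s x (by lia)
      rwa [show #s - 1 = m by lia] at this
    rw [Lagrange.nodal_insert_eq_nodal hi, sub_mul, coeff_sub, coeff_C_mul, hc, sum_insert hi,
      sum_insert hi]
    cases m with
    | zero =>
      obtain ⟨k, rfl⟩ := card_eq_one.1 (show #s = 1 by lia)
      simp
      ring
    | succ m =>
      rw [coeff_X_mul, mul_sub, ih m (by lia)]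
      ring

variable {N : ℕ} {a : Fin N → ℝ}

theorem sum_cons_borderData (l : Fin (N + 1) → ℝ) :
    ∑ k, (Fin.cons (borderData a l 0) a : Fin (N + 1) → ℝ) k = ∑ k, l k := by
  simp [Fin.sum_univ_succ, borderData]

/-- The Frobenius norm identity `∑ l_k² = c² + 2 ∑ w_j + ∑ a_j²`, obtained by comparing the
coefficients of degree `N - 1` of `∏ (X - l_k)` and `(X - c) ∏ (X - a_j)`. -/
theorem sum_sq_eq_borderData (ha : Function.Injective a) (l : Fin (N + 1) → ℝ) :
    ∑ k, l k ^ 2 =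
      borderData a l 0 ^ 2 + 2 * ∑ j : Fin N, borderData a l j.succ + ∑ j, a j ^ 2 := by
  cases N with
  | zero => simp [borderData]
  | succ M =>
    -- The roots of `(X - c) ∏ (X - a_j)`: the two monic polynomials have the same root sum, so
    -- their difference is determined by its values at the nodes, where `∏ (X - b_k)` vanishes.
    set b : Fin (M + 2) → ℝ := Fin.cons (borderData a l 0) a with hb
    have hsum : ∑ k, b k = ∑ k, l k := sum_cons_borderData l
    have hdeg := degree_nodal_sub_nodal_lt hsum.symm
    have h1 := Lagrange.coeff_eq_sum (s := univ) (v := a) ha.injOn (by simpa using hdeg)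
    have h2 : ∑ j : Fin (M + 1), borderData a l j.succ =
        -((Lagrange.nodal univ l).coeff M - (Lagrange.nodal univ b).coeff M) := by
      rw [← coeff_sub]
      simp only [card_univ, Fintype.card_fin, Nat.add_sub_cancel] at h1
      rw [h1, ← sum_neg_distrib]
      refine sum_congr rfl fun j _ => ?_
      have h0 : eval (a j) (Lagrange.nodal univ b) = 0 := by
        simpa [hb] using Lagrange.eval_nodal_at_node (v := b) (mem_univ j.succ)
      rw [eval_sub, h0, Lagrange.eval_nodal]
      simp [borderData, nodeProd, neg_div]
    have h3 := two_mul_coeff_nodal univ l M (by simp)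
    have h4 := two_mul_coeff_nodal univ b M (by simp)
    have h5 : ∑ k, b k ^ 2 = borderData a l 0 ^ 2 + ∑ j, a j ^ 2 := by
      simp [Fin.sum_univ_succ, hb]
    rw [h2]
    rw [hsum, h5] at h4
    linarith

theorem injOn_borderData (ha : Function.Injective a) :
    Set.InjOn (borderData a) {l | Interlaces l a} := by
  intro l hl l' hl' h
  have hsum : ∑ k, l k = ∑ k, l' k := by
    simpa [borderData] using congrFun h 0
  have heq : Lagrange.nodal univ l = Lagrange.nodal univ l' := by
    refine eq_of_degree_sub_lt_of_eval_index_eq univ ha.injOn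
      (by simpa using degree_nodal_sub_nodal_lt hsum) fun j _ => ?_
    have := congrFun h j.succ
    simp only [borderData, Fin.cons_succ, div_left_inj' (nodeProd_ne_zero ha j), neg_inj] at this
    simpa [Lagrange.eval_nodal] using this
  have hroot : ∀ (z : Fin (N + 1) → ℝ) (t : ℝ),
      t ∈ Set.range z ↔ eval t (Lagrange.nodal univ z) = 0 := by
    intro z t
    rw [Lagrange.eval_nodal, prod_eq_zero_iff]
    simp [sub_eq_zero, eq_comm]
  have hrange : Set.range l = Set.range l' := by
    ext t
    rw [hroot, hroot, heq]
  -- Strictly monotone enumerations of the same set agree; negation makes the sequences increasing.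
  have hneg : Set.range (fun k => -l k) = Set.range (fun k => -l' k) := by
    simpa [Set.range_comp', Function.comp_def] using congrArg (fun s => Neg.neg '' s) hrange
  have := StrictMono.range_inj (f := fun k => -l k) (g := fun k => -l' k)
    hl.strictAnti.neg hl'.strictAnti.neg |>.1 hneg
  funext k
  exact neg_injective (congrFun this k)

end Nodal

/-! ### The characteristic polynomial of the bordered matrix -/

section Eigenvalues

open Finset Polynomial

variable {N : ℕ} {a : Fin N → ℝ}

theorem eval_charpoly_borderedMatrix_of_notMem_range (a : Fin N → ℝ) (c : ℝ) (v : Fin N → ℂ)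
    {x : ℂ} (hx : ∀ j, x ≠ a j) :
    (borderedMatrix a c v).charpoly.eval x =
      (∏ j, (x - a j)) * (x - c - ∑ j, v j * star (v j) / (x - a j)) := by
  have hx' : ∀ j, x - a j ≠ 0 := fun j => sub_ne_zero.2 (hx j)
  have hmul : Matrix.diagonal (fun j => x - (a j : ℂ)) *
      Matrix.diagonal (fun j => (x - (a j : ℂ))⁻¹) = 1 := by
    rw [Matrix.diagonal_mul_diagonal, ← Matrix.diagonal_one]
    congr 1
    funext j
    exact mul_inv_cancel₀ (hx' j)
  let : Invertible (Matrix.diagonal fun j => x - (a j : ℂ)) :=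
    ⟨_, mul_eq_one_comm.1 hmul, hmul⟩
  have hblock : Matrix.scalar (Unit ⊕ Fin N) x - borderedMatrix a c v =
      Matrix.fromBlocks (Matrix.of fun _ _ => x - c) (Matrix.of fun _ j => -star (v j))
        (Matrix.of fun j _ => -v j) (Matrix.diagonal fun j => x - (a j : ℂ)) := by
    ext i j
    rcases i with i | i <;> rcases j with j | j
    · simp [borderedMatrix, Matrix.scalar_apply]
    · simp [borderedMatrix, Matrix.scalar_apply]
    · simp [borderedMatrix, Matrix.scalar_apply]
    · by_cases hij : i = j
      · simp [borderedMatrix, Matrix.scalar_apply, hij]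
      · simp [borderedMatrix, Matrix.scalar_apply, hij]
  rw [Matrix.eval_charpoly, hblock, Matrix.det_fromBlocks₂₂, Matrix.det_diagonal,
    Matrix.det_unique]
  congr 1
  have hinv : ⅟(Matrix.diagonal fun j => x - (a j : ℂ)) =
    Matrix.diagonal fun j => (x - (a j : ℂ))⁻¹ := rfl
  rw [hinv]
  rw [Matrix.sub_apply, Matrix.mul_apply]
  simp only [Matrix.of_apply, Matrix.mul_diagonal]
  congr 1
  refine sum_congr rfl fun j _ => ?_
  rw [div_eq_mul_inv]
  ring

/-- The Schur complement formula for the characteristic polynomial is a rational identity away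
from the nodes; after clearing denominators it is an identity of polynomials, which can be evaluated
at the nodes. -/
theorem eval_charpoly_borderedMatrix_node (a : Fin N → ℝ) (c : ℝ) (v : Fin N → ℂ) (j : Fin N) :
    (borderedMatrix a c v).charpoly.eval (a j : ℂ) =
      ((-(Complex.normSq (v j) * nodeProd a j) : ℝ) : ℂ) := by
  have hpoly : (borderedMatrix a c v).charpoly =
      (X - C (c : ℂ)) * ∏ j, (X - C (a j : ℂ)) -
        ∑ j, C (v j * star (v j)) * ∏ k ∈ univ.erase j, (X - C (a k : ℂ)) := by
    refine eq_of_infinite_eval_eq _ _ (Set.Infinite.mono ?_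
      (Set.finite_range fun j => (a j : ℂ)).infinite_compl)
    intro x hx
    have hx' : ∀ j, x ≠ a j := fun j h => hx ⟨j, h.symm⟩
    simp only [Set.mem_ofPred_eq]
    rw [eval_charpoly_borderedMatrix_of_notMem_range a c v hx', mul_sub]
    simp only [eval_sub, eval_mul, eval_X, eval_C, eval_prod, eval_finsetSum]
    rw [mul_comm, mul_sum]
    congr 1
    refine sum_congr rfl fun j _ => ?_
    rw [← mul_prod_erase univ _ (mem_univ j)]
    field_simp [sub_ne_zero.2 (hx' j)]
  rw [hpoly]
  simp only [eval_sub, eval_mul, eval_X, eval_C, eval_prod, eval_finsetSum]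
  rw [prod_eq_zero (mem_univ j) (sub_self _), mul_zero, zero_sub, sum_eq_single j]
  · simp [nodeProd, Complex.mul_conj]
  · intro i _ hij
    rw [prod_eq_zero (mem_erase.2 ⟨hij.symm, mem_univ j⟩) (sub_self _), mul_zero]
  · simp

theorem borderedEigenvalues_antitone (a : Fin N → ℝ) (c : ℝ) (v : Fin N → ℂ) :
    Antitone (borderedEigenvalues a c v) := fun _ _ h =>
  (borderedMatrix_isHermitian a c v).eigenvalues₀_antitone h

theorem map_eigenvalues_eq_map_borderedEigenvalues (a : Fin N → ℝ) (c : ℝ) (v : Fin N → ℂ) :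
    univ.val.map (borderedMatrix_isHermitian a c v).eigenvalues =
      univ.val.map (borderedEigenvalues a c v) := by
  have hcard : N + 1 = Fintype.card (Unit ⊕ Fin N) := by simp [add_comm]
  set e : Fin (N + 1) ≃ (Unit ⊕ Fin N) :=
    (finCongr hcard).trans (Fintype.equivOfCardEq (Fintype.card_fin _))
  have he : borderedEigenvalues a c v = (borderedMatrix_isHermitian a c v).eigenvalues ∘ e := by
    funext k
    simp [borderedEigenvalues, Matrix.IsHermitian.eigenvalues, e]
  rw [he, ← Multiset.map_map]
  congr 1
  simp

theorem sum_borderedEigenvalues (a : Fin N → ℝ) (c : ℝ) (v : Fin N → ℂ) :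
    ∑ k, borderedEigenvalues a c v k = c + ∑ j, a j := by
  have h1 : ∑ k, borderedEigenvalues a c v k =
      ∑ i, (borderedMatrix_isHermitian a c v).eigenvalues i := by
    simp only [sum_eq_multiset_sum, map_eigenvalues_eq_map_borderedEigenvalues]
  have h2 := (borderedMatrix_isHermitian a c v).trace_eq_sum_eigenvalues
  rw [h1]
  have h3 : (borderedMatrix a c v).trace = c + ∑ j, (a j : ℂ) := by
    simp [Matrix.trace, borderedMatrix]
  rw [h3] at h2
  simpa using congrArg Complex.re h2.symm

theorem prod_sub_borderedEigenvalues (a : Fin N → ℝ) (c : ℝ) (v : Fin N → ℂ) (j : Fin N) :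
    ∏ k, (a j - borderedEigenvalues a c v k) = -(Complex.normSq (v j) * nodeProd a j) := by
  have h1 : ∏ k, (a j - borderedEigenvalues a c v k) =
      ∏ i, (a j - (borderedMatrix_isHermitian a c v).eigenvalues i) := by
    have := congrArg (fun s => (s.map fun t => a j - t).prod)
      (map_eigenvalues_eq_map_borderedEigenvalues a c v)
    simp only [Multiset.map_map] at this
    exact this.symm
  have h2 := eval_charpoly_borderedMatrix_node a c v j
  rw [(borderedMatrix_isHermitian a c v).charpoly_eq, eval_prod] at h2
  rw [h1]
  simp only [eval_sub, eval_X, eval_C, Complex.coe_algebraMap] at h2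
  exact_mod_cast h2

theorem borderData_borderedEigenvalues (ha : Function.Injective a) (c : ℝ) (v : Fin N → ℂ) :
    borderData a (borderedEigenvalues a c v) = Fin.cons c fun j => Complex.normSq (v j) := by
  funext i
  refine Fin.cases ?_ (fun j => ?_) i
  · simp [borderData, sum_borderedEigenvalues]
  · simp only [borderData, Fin.cons_succ, prod_sub_borderedEigenvalues, neg_neg]
    exact mul_div_cancel_right₀ _ (nodeProd_ne_zero ha j)

end Eigenvalues

/-! ### Interlacing of the eigenvalues -/

section SignCounting

open Finset Polynomial

theorem sign_prod_eq_neg_one_pow {ι : Type*} (s : Finset ι) (f : ι → ℝ)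
    (hf : ∀ i ∈ s, f i ≠ 0) :
    SignType.sign (∏ i ∈ s, f i) = (-1) ^ #{i ∈ s | f i < 0} := by
  have h : SignType.sign (∏ i ∈ s, f i) = ∏ i ∈ s, SignType.sign (f i) :=
    map_prod (signHom (α := ℝ)) f s
  rw [h, ← prod_const, prod_filter]
  refine prod_congr rfl fun i hi => ?_
  rcases lt_or_gt_of_ne (hf i hi) with h0 | h0
  · simp [h0]
  · simp [h0, h0.le]

variable {N : ℕ} {a : Fin N → ℝ} {l : Fin (N + 1) → ℝ}

/-- A bounded nondecreasing integer sequence whose parity alternates is determined. -/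
theorem eq_add_one_of_monotone_of_parity {n : Fin N → ℕ} (hmono : Monotone n)
    (hle : ∀ j, n j ≤ N + 1) (hpar : ∀ j, n j % 2 = (j + 1) % 2) (j : Fin N) : n j = j + 1 := by
  have hlow : ∀ i (hi : i < N), i + 1 ≤ n ⟨i, hi⟩ := by
    intro i
    induction i with
    | zero => intro hi; have := hpar ⟨0, hi⟩; simp at this ⊢; lia
    | succ i ih =>
      intro hi
      have h1 := ih (by lia)
      have h2 : n ⟨i, by lia⟩ ≤ n ⟨i + 1, hi⟩ := hmono (by simp)
      have h3 := hpar ⟨i + 1, hi⟩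
      simp only at h3
      lia
  have hup : ∀ i (hi : i < N), n ⟨N - 1 - i, by lia⟩ ≤ N - i := by
    intro i
    induction i with
    | zero =>
      intro hi
      have h1 := hpar ⟨N - 1 - 0, by lia⟩
      have h2 := hle ⟨N - 1 - 0, by lia⟩
      simp only at h1
      lia
    | succ i ih =>
      intro hi
      have h1 := ih (by lia)
      have h2 : n ⟨N - 1 - (i + 1), by lia⟩ ≤ n ⟨N - 1 - i, by lia⟩ :=
        hmono (by simp only [Fin.mk_le_mk]; lia)
      have h3 := hpar ⟨N - 1 - (i + 1), by lia⟩
      simp only at h3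
      lia
  have h1 := hlow j j.2
  have h2 := hup (N - 1 - j) (by lia)
  have h3 : (⟨N - 1 - (N - 1 - (j : ℕ)), by lia⟩ : Fin N) = j := Fin.ext (by simp only; lia)
  rw [h3] at h2
  simp only [Fin.eta] at h1
  lia

/-- Let `∏ (X - l_k)` alternate in sign along the nodes `a_j` as the characteristic polynomial of a
bordered matrix does. The number of `l_k` above `a_j` is then nondecreasing in `j`, at most `N + 1`
and alternates in parity, so it equals `j + 1`, and the interlacing follows. -/
theorem interlaces_of_prod_sub_eq (ha : StrictAnti a) (hl : Antitone l) {w : Fin N → ℝ}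
    (hw : ∀ j, 0 < w j) (h : ∀ j, ∏ k, (a j - l k) = -(w j * nodeProd a j)) :
    Interlaces l a := by
  have hne : ∀ j k, a j - l k ≠ 0 := by
    intro j k hk
    have := h j
    rw [prod_eq_zero (mem_univ k) hk, eq_comm, neg_eq_zero] at this
    exact mul_ne_zero (hw j).ne' (nodeProd_ne_zero ha.injective j) this
  -- `n j` is the number of `l_k` above `a_j`, whose parity is that of the sign of `∏ (a_j - l_k)`.
  set n : Fin N → ℕ := fun j => #{k | a j - l k < 0} with hn
  have hmono : Monotone n := fun i j hij => card_le_card fun k hk => by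
    simp only [mem_filter, mem_univ, true_and] at hk ⊢
    linarith [ha.antitone hij]
  have hle : ∀ j, n j ≤ N + 1 := fun j => by
    simpa [hn] using card_filter_le (univ : Finset (Fin (N + 1))) (fun k => a j - l k < 0)
  have hnode : ∀ j, SignType.sign (nodeProd a j) = (-1) ^ (j : ℕ) := by
    intro j
    rw [nodeProd, sign_prod_eq_neg_one_pow]
    · congr 1
      have : ({k ∈ univ.erase j | a j - a k < 0} : Finset (Fin N)) = Iio j := by
        ext k
        simp only [mem_filter, mem_erase, mem_univ, and_true, mem_Iio, sub_neg, ha.lt_iff_gt]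
        exact ⟨fun h => h.2, fun h => ⟨h.ne, h⟩⟩
      rw [this, Fin.card_Iio]
    · intro k hk
      exact sub_ne_zero.2 fun h => (mem_erase.1 hk).1 (ha.injective h).symm
  have hpar : ∀ j, n j % 2 = (j + 1) % 2 := by
    intro j
    have h1 := congrArg SignType.sign (h j)
    rw [sign_prod_eq_neg_one_pow _ _ fun k _ => hne j k, Left.sign_neg, sign_mul, hnode,
      sign_pos (hw j), one_mul] at h1
    change (-1) ^ n j = _ at h1
    rcases Nat.even_or_odd (n j) with he | he <;> rcases Nat.even_or_odd (j : ℕ) with hj | hj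
    · rw [he.neg_one_pow, hj.neg_one_pow] at h1
      exact absurd h1 (by decide)
    · grind
    · grind
    · rw [he.neg_one_pow, hj.neg_one_pow] at h1
      exact absurd h1 (by decide)
  have hcount := eq_add_one_of_monotone_of_parity hmono hle hpar
  intro j
  constructor
  · by_contra hlt
    have hsub : ({k | a j - l k < 0} : Finset (Fin (N + 1))) ⊆ Iio j.castSucc := fun k hk => by
      simp only [mem_filter, mem_univ, true_and, mem_Iio] at hk ⊢
      by_contra hk'
      linarith [hl (not_lt.1 hk')]
    have := card_le_card hsub
    rw [Fin.card_Iio] at this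
    have h2 := hcount j
    simp only [hn, Fin.val_castSucc] at this h2
    lia
  · by_contra hlt
    have hsub : Iic j.succ ⊆ ({k | a j - l k < 0} : Finset (Fin (N + 1))) := fun k hk => by
      simp only [mem_filter, mem_univ, true_and, mem_Iic] at hk ⊢
      refine lt_of_le_of_ne ?_ (hne j k)
      linarith [hl hk]
    have := card_le_card hsub
    rw [Fin.card_Iic] at this
    have h2 := hcount j
    simp only [hn, Fin.val_succ] at this h2
    lia

theorem interlaces_borderedEigenvalues (ha : StrictAnti a) (c : ℝ) {v : Fin N → ℂ}
    (hv : ∀ j, v j ≠ 0) : Interlaces (borderedEigenvalues a c v) a :=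
  interlaces_of_prod_sub_eq ha (borderedEigenvalues_antitone a c v)
    (fun j => Complex.normSq_pos.2 (hv j)) (prod_sub_borderedEigenvalues a c v)

end SignCounting

/-! ### The Jacobian determinant -/

section Jacobian

open Finset Polynomial

variable {N : ℕ}

/-- The Jacobian matrix of `borderData a` at `l`. -/
noncomputable def borderJacobian (a : Fin N → ℝ) (l : Fin (N + 1) → ℝ) :
    Matrix (Fin (N + 1)) (Fin (N + 1)) ℝ :=
  Matrix.of (Fin.cons (fun _ => 1) fun j k => (∏ i ∈ univ.erase k, (a j - l i)) / nodeProd a j)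

theorem hasFDerivAt_borderData (a : Fin N → ℝ) (l : Fin (N + 1) → ℝ) :
    HasFDerivAt (borderData a)
      (LinearMap.toContinuousLinearMap (Matrix.toLin' (borderJacobian a l))) l := by
  have hproj : ∀ k : Fin (N + 1), HasFDerivAt (fun x : Fin (N + 1) → ℝ => x k)
      (ContinuousLinearMap.proj (R := ℝ) (φ := fun _ : Fin (N + 1) => ℝ) k) l :=
    fun k => (ContinuousLinearMap.proj (R := ℝ) (φ := fun _ : Fin (N + 1) => ℝ) k).hasFDerivAt
  refine hasFDerivAt_pi'.2 fun i => ?_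
  refine Fin.cases ?_ (fun j => ?_) i
  · have h := (HasFDerivAt.fun_sum fun k (_ : k ∈ univ) => hproj k).sub_const (∑ j, a j)
    refine h.congr_fderiv ?_
    ext x
    simp [borderJacobian, Matrix.mulVec, dotProduct]
  · have h := ((HasFDerivAt.finsetProd (u := univ) fun k _ =>
      (hproj k).const_sub (a j)).neg.mul_const (nodeProd a j)⁻¹)
    refine h.congr_fderiv ?_
    ext x
    simp only [FunLike.coe_smul, FunLike.coe_sum, Pi.smul_apply,
      neg_apply, Finset.sum_apply, smul_eq_mul]
    simp [borderJacobian, Matrix.mulVec, dotProduct, mul_sum]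
    exact sum_congr rfl fun k _ => by ring

/-- Lagrange interpolation at the nodes `l_k` expresses the leading coefficient and the values at
the `a_j` of a polynomial of degree at most `N` through its values at the `l_k`. Applied to the
monomials, it reads as this matrix identity. -/
theorem borderJacobian_mul_vandermonde (a : Fin N → ℝ) {l : Fin (N + 1) → ℝ}
    (hl : Function.Injective l) :
    borderJacobian a l * (Matrix.diagonal (fun k => (nodeProd l k)⁻¹) * Matrix.vandermonde l) =
      Matrix.of (Fin.cons (fun m => if m = Fin.last N then 1 else 0)
        fun j m => a j ^ (m : ℕ) / nodeProd a j) := by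
  ext i m
  have hdeg : (X ^ (m : ℕ) : ℝ[X]).degree < #(univ : Finset (Fin (N + 1))) := by
    rw [degree_X_pow, card_univ, Fintype.card_fin]
    exact_mod_cast m.2
  rw [Matrix.mul_apply]
  simp only [Matrix.diagonal_mul, Matrix.vandermonde_apply, borderJacobian,
    Matrix.of_apply]
  refine Fin.cases ?_ (fun j => ?_) i
  · have h := Lagrange.coeff_eq_sum (s := univ) hl.injOn hdeg
    simp only [card_univ, Fintype.card_fin, Nat.add_sub_cancel, coeff_X_pow, eval_pow, eval_X] at h
    simp only [Fin.cons_zero, one_mul, Fin.ext_iff, Fin.val_last, eq_comm (a := (m : ℕ)), h]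
    exact sum_congr rfl fun k _ => by rw [div_eq_inv_mul]; rfl
  · have h := congrArg (eval (a j)) (Lagrange.eq_interpolate (s := univ) hl.injOn hdeg)
    rw [Lagrange.interpolate_apply, eval_finsetSum] at h
    simp only [eval_pow, eval_X] at h
    simp only [Fin.cons_succ]
    rw [h, sum_div]
    refine sum_congr rfl fun k _ => ?_
    simp only [eval_mul, eval_C, eval_X, Lagrange.basis, Lagrange.basisDivisor,
      eval_prod, eval_sub, prod_mul_distrib, prod_inv_distrib, nodeProd]
    ring

theorem abs_det_monomial_rows (a : Fin N → ℝ) :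
    |(Matrix.of (Fin.cons (fun m => if m = Fin.last N then 1 else 0)
        fun j m => a j ^ (m : ℕ) / nodeProd a j) : Matrix (Fin (N + 1)) (Fin (N + 1)) ℝ).det| =
      |vandermondeProd a| / |∏ j, nodeProd a j| := by
  rw [Matrix.det_succ_row_zero, sum_eq_single (Fin.last N)]
  · have hsub : ((Matrix.of (Fin.cons (fun m => if m = Fin.last N then 1 else 0)
        fun j m => a j ^ (m : ℕ) / nodeProd a j) : Matrix (Fin (N + 1)) (Fin (N + 1)) ℝ).submatrix
          Fin.succ (Fin.last N).succAbove) =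
        Matrix.diagonal (fun j => (nodeProd a j)⁻¹) * Matrix.vandermonde a := by
      ext j m
      simp [Matrix.diagonal_mul, Matrix.vandermonde_apply, div_eq_mul_inv, mul_comm]
    rw [hsub, Matrix.det_mul, Matrix.det_diagonal, prod_inv_distrib]
    simp only [abs_mul, abs_pow, abs_neg, abs_one, one_pow, Matrix.of_apply, Fin.cons_zero, if_true,
      one_mul, abs_inv, abs_det_vandermonde]
    rw [div_eq_mul_inv, mul_comm]
  · intro m _ hm
    simp [hm]
  · simp

theorem abs_det_borderJacobian {a : Fin N → ℝ} {l : Fin (N + 1) → ℝ} (ha : StrictAnti a)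
    (hl : StrictAnti l) :
    |(borderJacobian a l).det| = vandermondeProd l / vandermondeProd a := by
  have h := congrArg (fun M => |Matrix.det M|) (borderJacobian_mul_vandermonde a hl.injective)
  simp only [Matrix.det_mul, Matrix.det_diagonal, abs_mul, prod_inv_distrib, abs_inv,
    abs_det_monomial_rows, abs_prod_nodeProd, abs_det_vandermonde] at h
  have hpa := vandermondeProd_pos ha
  have hpl := vandermondeProd_pos hl
  rw [abs_of_pos hpa, abs_of_pos hpl] at h
  field_simp at h ⊢
  exact h

end Jacobian

/-! ### Products of densities -/

section ProductDensities

open MeasureTheory ProbabilityTheory ENNReal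

theorem lintegral_pi_prod_eq_prod_lintegral {n : ℕ} {f : Fin n → ℝ → ℝ≥0∞}
    (hf : ∀ i, Measurable (f i)) :
    ∫⁻ x : Fin n → ℝ, ∏ i, f i (x i) = ∏ i, ∫⁻ t, f i t := by
  induction n with
  | zero => simp [volume_pi]
  | succ n ih =>
    have hmp := (volume_preserving_piFinSuccAbove (fun _ : Fin (n + 1) => ℝ) 0).symm
    rw [← hmp.lintegral_comp (by fun_prop)]
    simp only [Fin.prod_univ_succ]
    simp only [MeasurableEquiv.piFinSuccAbove_symm_apply, Fin.insertNthEquiv_apply,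
      Fin.insertNth_zero', Fin.cons_zero, Fin.cons_succ]
    rw [Measure.volume_eq_prod, lintegral_prod_mul (f := f 0)
      (g := fun y : Fin n → ℝ => ∏ i, f i.succ (y i)) (hf 0).aemeasurable
      (Measurable.aemeasurable (by fun_prop)), ih fun i => hf i.succ]

theorem pi_withDensity {n : ℕ} {f : Fin n → ℝ → ℝ≥0∞} (hf : ∀ i, Measurable (f i))
    [∀ i, SigmaFinite (volume.withDensity (f i))] :
    Measure.pi (fun i => volume.withDensity (f i)) =
      (volume : Measure (Fin n → ℝ)).withDensity fun x => ∏ i, f i (x i) := by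
  refine Measure.pi_eq fun s hs => ?_
  rw [withDensity_apply _ (MeasurableSet.univ_pi hs), ← lintegral_indicator (.univ_pi hs)]
  have hind : ∀ x : Fin n → ℝ, (Set.univ.pi s).indicator (fun x => ∏ i, f i (x i)) x =
      ∏ i, (s i).indicator (f i) (x i) := by
    intro x
    by_cases hx : x ∈ Set.univ.pi s
    · rw [Set.indicator_of_mem hx]
      exact Finset.prod_congr rfl fun i _ => (Set.indicator_of_mem (hx i trivial) _).symm
    · obtain ⟨i, hi⟩ : ∃ i, x i ∉ s i := by simpa using hx
      rw [Set.indicator_of_notMem hx, Finset.prod_eq_zero (Finset.mem_univ i)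
        (Set.indicator_of_notMem hi _)]
  simp only [hind]
  rw [lintegral_pi_prod_eq_prod_lintegral fun i => (hf i).indicator (hs i)]
  refine Finset.prod_congr rfl fun i _ => ?_
  rw [withDensity_apply _ (hs i), lintegral_indicator (hs i)]

end ProductDensities

/-! ### The squared modulus of a complex Gaussian -/

section SquaredModulus

open MeasureTheory ProbabilityTheory ENNReal

/-- In polar coordinates the density of `N[0, s] + i N[0, s]` depends only on the radius `r`, and
the substitution `t = r²` absorbs the factor `r` of the area element. -/
theorem lintegral_normSq_complexNormal {s : ℝ} (hs : 0 < s) {f : ℝ → ℝ≥0∞} (hf : Measurable f) :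
    ∫⁻ z, f (Complex.normSq z) ∂complexNormal s = ∫⁻ t in Set.Ioi 0,
      ENNReal.ofReal ((2 * s ^ 2)⁻¹ * Real.exp (-((2 * s ^ 2)⁻¹ * t))) * f t := by
  have hvar : (s ^ 2).toNNReal ≠ 0 := by simpa using hs.ne'
  have hcoe : ((s ^ 2).toNNReal : ℝ) = s ^ 2 := Real.coe_toNNReal _ (sq_nonneg s)
  have hmk : Measurable fun p : ℝ × ℝ => (⟨p.1, p.2⟩ : ℂ) :=
    Complex.measurableEquivRealProd.symm.measurable
  have hsq : Measurable Complex.normSq := Complex.continuous_normSq.measurable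
  have hpdf : Measurable (gaussianPDF 0 (s ^ 2).toNNReal) := measurable_gaussianPDF _ _
  have hdens : ∀ r θ : ℝ, gaussianPDF 0 (s ^ 2).toNNReal (r * Real.cos θ) *
      gaussianPDF 0 (s ^ 2).toNNReal (r * Real.sin θ) =
      ENNReal.ofReal ((2 * Real.pi * s ^ 2)⁻¹ * Real.exp (-((2 * s ^ 2)⁻¹ * r ^ 2))) := by
    intro r θ
    rw [gaussianPDF, gaussianPDF, ← ENNReal.ofReal_mul (gaussianPDFReal_nonneg _ _ _)]
    congr 1
    simp only [gaussianPDFReal, hcoe, sub_zero]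
    rw [mul_mul_mul_comm, ← mul_inv, Real.mul_self_sqrt (by positivity), ← Real.exp_add]
    congr 2
    have := Real.sin_sq_add_cos_sq θ
    field_simp
    linear_combination (-r ^ 2) * this
  rw [complexNormal, lintegral_map (f := fun z => f (Complex.normSq z)) (hf.comp hsq) hmk,
    realNormal, gaussianReal_of_var_ne_zero _ hvar,
    prod_withDensity hpdf hpdf, lintegral_withDensity_eq_lintegral_mul _ (by fun_prop)
      (g := fun p : ℝ × ℝ => f (Complex.normSq ⟨p.1, p.2⟩)) (hf.comp (hsq.comp hmk)),
    ← Measure.volume_eq_prod, ← lintegral_comp_polarCoord_symm]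
  have himage : (fun r : ℝ => r ^ 2) '' Set.Ioi 0 = Set.Ioi 0 := by
    ext t
    constructor
    · rintro ⟨r, hr, rfl⟩
      exact pow_pos (Set.mem_Ioi.1 hr) 2
    · intro ht
      exact ⟨√t, Real.sqrt_pos.2 ht, Real.sq_sqrt (Set.mem_Ioi.1 ht).le⟩
  have hinj : Set.InjOn (fun r : ℝ => r ^ 2) (Set.Ioi 0) := fun x hx y hy h =>
    (pow_left_inj₀ (Set.mem_Ioi.1 hx).le (Set.mem_Ioi.1 hy).le two_ne_zero).1 h
  conv_rhs => rw [← himage]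
  rw [lintegral_image_eq_lintegral_abs_deriv_mul (f' := fun r => 2 * r) measurableSet_Ioi
    (fun r _ => by simpa using (hasDerivAt_pow 2 r).hasDerivWithinAt) hinj]
  have htarget : polarCoord.target = Set.Ioi (0 : ℝ) ×ˢ Set.Ioo (-Real.pi) Real.pi := rfl
  have hint : ∀ p : ℝ × ℝ, p ∈ polarCoord.target →
      ENNReal.ofReal p.1 • ((fun z : ℝ × ℝ => gaussianPDF 0 (s ^ 2).toNNReal z.1 *
        gaussianPDF 0 (s ^ 2).toNNReal z.2) * fun a : ℝ × ℝ => f (Complex.normSq ⟨a.1, a.2⟩))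
          (polarCoord.symm p) =
      ENNReal.ofReal (p.1 * ((2 * Real.pi * s ^ 2)⁻¹ *
        Real.exp (-((2 * s ^ 2)⁻¹ * p.1 ^ 2)))) * f (p.1 ^ 2) := by
    rintro ⟨r, θ⟩ hp
    have hr : 0 < r := hp.1
    have hn : Complex.normSq ⟨r * Real.cos θ, r * Real.sin θ⟩ = r ^ 2 := by
      rw [Complex.normSq_mk]
      linear_combination r ^ 2 * Real.sin_sq_add_cos_sq θ
    simp only [polarCoord_symm_apply, Pi.mul_apply, smul_eq_mul, hdens, hn]
    rw [← mul_assoc, ← ENNReal.ofReal_mul hr.le]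
  rw [setLIntegral_congr_fun (polarCoord.open_target.measurableSet) hint, htarget,
    Measure.volume_eq_prod, ← Measure.prod_restrict, lintegral_prod _ (by fun_prop)]
  simp only [lintegral_const, Measure.restrict_apply_univ, Real.volume_Ioo]
  refine setLIntegral_congr_fun measurableSet_Ioi fun r hr => ?_
  have hr : 0 < r := hr
  have hpi := Real.pi_pos
  rw [mul_right_comm, ← ENNReal.ofReal_mul (by positivity), abs_of_pos (by positivity),
    ← mul_assoc (ENNReal.ofReal _), ← ENNReal.ofReal_mul (by positivity)]
  congr 2
  field_simp
  ring

theorem hasLaw_normSq_complexNormal {s : ℝ} (hs : 0 < s) :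
    HasLaw Complex.normSq (volume.withDensity (exponentialPDF (2 * s ^ 2)⁻¹))
      (complexNormal s) := by
  have hsq : Measurable Complex.normSq := Complex.continuous_normSq.measurable
  refine ⟨hsq.aemeasurable, ?_⟩
  refine Measure.ext fun A hA => ?_
  have h := lintegral_normSq_complexNormal hs (f := A.indicator 1) (measurable_one.indicator hA)
  have h1 : (fun z => A.indicator (1 : ℝ → ℝ≥0∞) (Complex.normSq z)) =
      (Complex.normSq ⁻¹' A).indicator 1 := rfl
  rw [h1, lintegral_indicator_one (hsq hA)] at h
  rw [Measure.map_apply hsq hA, h, withDensity_apply _ hA, ← lintegral_indicator hA,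
    ← lintegral_indicator measurableSet_Ioi]
  -- `exponentialPDF` is nonzero at `0`, unlike the indicator of the half-line `0 < t`.
  have h0 : ∀ᵐ t : ℝ, t ≠ 0 := by simp [ae_iff]
  refine lintegral_congr_ae ?_
  filter_upwards [h0] with t ht
  rcases lt_or_gt_of_ne ht with ht | ht
  · rw [Set.indicator_of_notMem (by simpa using ht.le)]
    simp [Set.indicator, exponentialPDF_of_neg ht]
  · rw [Set.indicator_of_mem (Set.mem_Ioi.2 ht)]
    simp [Set.indicator, exponentialPDF_of_nonneg ht.le]

end SquaredModulus

/-! ### Change of variables for laws -/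

section ChangeOfVariables

open MeasureTheory ProbabilityTheory ENNReal

/-- If `T Y = X` and `T` is smooth and injective on a set carrying `Y`, then the law of `Y` is
obtained from that of `X` by the change of variables formula. The measurability of `Y` is part of
the conclusion: `Y` agrees almost surely with a measurable left inverse of `T` applied to `X`. -/
theorem hasLaw_of_injOn_of_hasFDerivWithinAt {Ω E : Type*} [MeasurableSpace Ω]
    [NormedAddCommGroup E] [NormedSpace ℝ E] [FiniteDimensional ℝ E] [MeasureSpace E]
    [BorelSpace E] [(volume : Measure E).IsAddHaarMeasure] {P : Measure Ω} {X Y : Ω → E}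
    {h : E → ℝ≥0∞} {T : E → E} {T' : E → E →L[ℝ] E} {s : Set E} (hs : MeasurableSet s)
    (hT' : ∀ x ∈ s, HasFDerivWithinAt T (T' x) s x) (hT : Set.InjOn T s)
    (hX : HasLaw X (volume.withDensity h) P) (hYs : ∀ᵐ ω ∂P, Y ω ∈ s)
    (hTY : ∀ᵐ ω ∂P, T (Y ω) = X ω) :
    HasLaw Y (volume.withDensity (s.indicator fun y => ENNReal.ofReal |(T' y).det| * h (T y)))
      P := by
  obtain ⟨g, hg, hgT⟩ := (measurableEmbedding_of_fderivWithin hs hT' hT).exists_measurable_extend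
    (g := (Subtype.val : s → E)) measurable_subtype_coe fun _ => ⟨0⟩
  have hYg : (fun ω => g (X ω)) =ᵐ[P] Y := by
    filter_upwards [hYs, hTY] with ω h1 h2
    rw [← h2]
    exact congrFun hgT ⟨Y ω, h1⟩
  have hYm : AEMeasurable Y P := (hg.comp_aemeasurable hX.aemeasurable).congr hYg
  refine ⟨hYm, Measure.ext fun A hA => ?_⟩
  have hAs : MeasurableSet (A ∩ s) := hA.inter hs
  have hT'A : ∀ x ∈ A ∩ s, HasFDerivWithinAt T (T' x) (A ∩ s) x :=
    fun x hx => (hT' x hx.2).mono Set.inter_subset_right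
  have hTA : Set.InjOn T (A ∩ s) := hT.mono Set.inter_subset_right
  have himage : MeasurableSet (T '' (A ∩ s)) := measurable_image_of_fderivWithin hAs hT'A hTA
  have hpre : Y ⁻¹' A =ᵐ[P] X ⁻¹' (T '' (A ∩ s)) := by
    filter_upwards [hYs, hTY] with ω h1 h2
    refine propext ⟨fun hω => ⟨Y ω, ⟨hω, h1⟩, h2⟩, ?_⟩
    rintro ⟨y, ⟨hyA, hys⟩, hy⟩
    have hyY : y = Y ω := hT hys h1 (hy.trans h2.symm)
    exact show Y ω ∈ A from hyY ▸ hyA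
  rw [Measure.map_apply_of_aemeasurable hYm hA, measure_congr hpre,
    ← Measure.map_apply_of_aemeasurable hX.aemeasurable himage, hX.map_eq,
    withDensity_apply _ himage,
    lintegral_image_eq_lintegral_abs_det_fderiv_mul volume hAs hT'A hTA,
    withDensity_apply _ hA, lintegral_indicator hs, Measure.restrict_restrict hs, Set.inter_comm]

end ChangeOfVariables

/-! ### The joint law of the corner and the squared moduli -/

section JointLaw

open MeasureTheory ProbabilityTheory ENNReal

variable {N : ℕ}

/-- The joint density of a Gaussian corner entry and exponentially distributed squared moduli,
with `V` the variance of the former and `r` the rate of the latter. -/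
noncomputable def cornerDensity (N : ℕ) (μ : ℝ) (V : NNReal) (r : ℝ) (x : Fin (N + 1) → ℝ) :
    ℝ≥0∞ :=
  gaussianPDF μ V (x 0) * ∏ j : Fin N, exponentialPDF r (x j.succ)

theorem hasLaw_corner_normSq {Ω : Type*} [MeasurableSpace Ω] {P : Measure Ω}
    [IsProbabilityMeasure P] {μ s t : ℝ} (hs : 0 < s) (ht : 0 < t) {c : Ω → ℝ} {v : Fin N → Ω → ℂ}
    (hc : HasLaw c (realNormal μ s) P) (hv : ∀ j, HasLaw (v j) (complexNormal t) P)
    (hvi : iIndepFun v P) (hcv : IndepFun c (fun ω j => v j ω) P) :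
    HasLaw (fun ω => (Fin.cons (c ω) fun j => Complex.normSq (v j ω) : Fin (N + 1) → ℝ))
      (volume.withDensity (cornerDensity N μ (s ^ 2).toNNReal (2 * t ^ 2)⁻¹)) P := by
  have hvar : (s ^ 2).toNNReal ≠ 0 := by simpa using hs.ne'
  have hsq : Measurable Complex.normSq := Complex.continuous_normSq.measurable
  have hrate : 0 < (2 * t ^ 2)⁻¹ := by positivity
  have hexp : Measurable (exponentialPDF (2 * t ^ 2)⁻¹) :=
    (measurable_exponentialPDFReal _).ennreal_ofReal
  set f : Fin (N + 1) → ℝ → ℝ≥0∞ :=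
    Fin.cons (gaussianPDF μ (s ^ 2).toNNReal) fun _ => exponentialPDF (2 * t ^ 2)⁻¹ with hf
  have hfm : ∀ i, Measurable (f i) :=
    Fin.cases (measurable_gaussianPDF _ _) fun _ => hexp
  have hprob : ∀ i, IsProbabilityMeasure (volume.withDensity (f i)) := by
    refine Fin.cases ?_ fun j => ?_
    · simp only [hf, Fin.cons_zero]
      rw [← gaussianReal_of_var_ne_zero _ hvar]
      infer_instance
    · exact isProbabilityMeasure_expMeasure hrate
  have hw : ∀ j : Fin N, HasLaw (fun ω => Complex.normSq (v j ω))
      (volume.withDensity (f j.succ)) P := fun j =>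
    (hasLaw_normSq_complexNormal ht).fun_comp (hv j)
  have hwi : iIndepFun (fun j ω => Complex.normSq (v j ω)) P :=
    hvi.comp (fun _ => Complex.normSq) fun _ => hsq
  have hc' : HasLaw c (volume.withDensity (f 0)) P := by
    simpa only [realNormal, gaussianReal_of_var_ne_zero _ hvar, hf, Fin.cons_zero] using hc
  have hcw : IndepFun c (fun ω j => Complex.normSq (v j ω)) P :=
    hcv.comp (φ := id) (ψ := fun z : Fin N → ℂ => fun j => Complex.normSq (z j)) measurable_id
      (measurable_pi_lambda _ fun j => hsq.comp (measurable_pi_apply j))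
  have hpair := hcw.hasLaw_prod hc' (hwi.hasLaw_pi hw)
  have hmp := (measurePreserving_piFinSuccAbove (fun i => volume.withDensity (f i)) 0).symm
  have h := hmp.fun_comp_hasLaw hpair
  have hdens : cornerDensity N μ (s ^ 2).toNNReal (2 * t ^ 2)⁻¹ = fun x => ∏ i, f i (x i) := by
    funext x
    simp [cornerDensity, Fin.prod_univ_succ, hf]
  rw [hdens, ← pi_withDensity hfm]
  simpa [Fin.consEquiv] using h

theorem ae_ne_zero_of_hasLaw_complexNormal {Ω : Type*} [MeasurableSpace Ω] {P : Measure Ω}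
    {t : ℝ} (ht : 0 < t) {z : Ω → ℂ} (hz : HasLaw z (complexNormal t) P) :
    ∀ᵐ ω ∂P, z ω ≠ 0 := by
  have h := (hasLaw_normSq_complexNormal ht).fun_comp hz
  have h0 : ∀ᵐ x ∂(volume.withDensity (exponentialPDF (2 * t ^ 2)⁻¹)), x ≠ (0 : ℝ) :=
    (withDensity_absolutelyContinuous _ _).ae_le (compl_mem_ae_iff.2 (measure_singleton 0))
  rw [← h.map_eq] at h0
  filter_upwards [ae_of_ae_map h.aemeasurable h0] with ω hω hz0
  exact hω (by simp [hz0])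

end JointLaw

/-! ### The density of the eigenvalues -/

section Density

open MeasureTheory ProbabilityTheory ENNReal

variable {N : ℕ} {a : Fin N → ℝ} {l : Fin (N + 1) → ℝ}

theorem abs_det_mul_cornerDensity {μ σ : ℝ} (hσ : 0 < σ) (ha : StrictAnti a)
    (h : Interlaces l a) :
    ENNReal.ofReal |(borderJacobian a l).det| *
        cornerDensity N μ ((σ / √2) ^ 2).toNNReal (2 * (σ / 2) ^ 2)⁻¹ (borderData a l) =
      ENNReal.ofReal (borderedDensity μ σ a l) := by
  have hpos := borderData_succ_pos ha h
  have hfrob := sum_sq_eq_borderData ha.injective l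
  have hr : (2 * (σ / 2) ^ 2)⁻¹ = 2 / σ ^ 2 := by field_simp
  have hV : (((σ / √2) ^ 2).toNNReal : ℝ) = (σ / √2) ^ 2 := Real.coe_toNNReal _ (sq_nonneg _)
  have hV' : (σ / √2) ^ 2 = σ ^ 2 / 2 := by rw [div_pow, Real.sq_sqrt zero_le_two]
  have hc : borderData a l 0 = ∑ k, l k - ∑ j, a j := rfl
  have hnorm : (√(2 * Real.pi * (σ / √2) ^ 2))⁻¹ = √2 / σ * √(1 / (2 * Real.pi)) := by
    rw [Real.sqrt_mul (by positivity), Real.sqrt_sq (by positivity), one_div, Real.sqrt_inv]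
    field_simp
  have hpow : (√2 / σ) ^ (2 * N + 1) = (2 / σ ^ 2) ^ N * (√2 / σ) := by
    rw [pow_succ, pow_mul, div_pow, Real.sq_sqrt zero_le_two]
  have hexp : Real.exp (-(borderData a l 0 - μ) ^ 2 / (2 * (σ / √2) ^ 2)) *
        Real.exp (∑ j : Fin N, -(2 / σ ^ 2 * borderData a l j.succ)) =
      Real.exp (-(σ ^ 2)⁻¹ * (∑ j, l j ^ 2 - ∑ j, a j ^ 2)) * Real.exp (-(μ / σ) ^ 2) *
        Real.exp (2 * μ * (σ ^ 2)⁻¹ * (∑ j, l j - ∑ j, a j)) := by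
    rw [← Real.exp_add, ← Real.exp_add, ← Real.exp_add, hfrob, ← hc, hV', Finset.sum_neg_distrib,
      ← Finset.mul_sum]
    congr 1
    field_simp
    ring
  rw [cornerDensity, gaussianPDF, Finset.prod_congr rfl fun j _ =>
      exponentialPDF_of_nonneg (hpos j).le,
    ← ENNReal.ofReal_prod_of_nonneg fun j _ => by positivity,
    ← ENNReal.ofReal_mul (gaussianPDFReal_nonneg _ _ _), ← ENNReal.ofReal_mul (abs_nonneg _),
    abs_det_borderJacobian ha h.strictAnti, borderedDensity, Set.indicator_of_mem (by exact h),
    hr, Finset.prod_mul_distrib, Finset.prod_const, Finset.card_univ, Fintype.card_fin,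
    ← Real.exp_sum, gaussianPDFReal, hV, hnorm, hpow]
  congr 1
  linear_combination (vandermondeProd l / vandermondeProd a * (√2 / σ * √(1 / (2 * Real.pi))) *
    (2 / σ ^ 2) ^ N) * hexp

end Density

theorem propositionp2 {Ω : Type*} [MeasurableSpace Ω] (P : MeasureTheory.Measure Ω)
    [MeasureTheory.IsProbabilityMeasure P]
    (N : ℕ) (μ σ : ℝ) (hσ : 0 < σ)
    (a : Fin N → ℝ) (ha : StrictAnti a)
    (c : Ω → ℝ) (v : Fin N → Ω → ℂ)
    (hc : ProbabilityTheory.HasLaw c (realNormal μ (σ / √2)) P)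
    (hv : ∀ j, ProbabilityTheory.HasLaw (v j) (complexNormal (σ / 2)) P)
    (hvi : ProbabilityTheory.iIndepFun v P)
    (hcv : ProbabilityTheory.IndepFun c (fun ω j => v j ω) P) :
    ProbabilityTheory.HasLaw (fun ω => borderedEigenvalues a (c ω) (fun j => v j ω))
      (MeasureTheory.volume.withDensity
        (fun l : Fin (N + 1) → ℝ => ENNReal.ofReal (borderedDensity μ σ a l))) P := by
  have hdet : ∀ l, (LinearMap.toContinuousLinearMap (Matrix.toLin' (borderJacobian a l))).det =
      (borderJacobian a l).det := fun l => by
    rw [LinearMap.det_toContinuousLinearMap, LinearMap.det_toLin']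
  have hX := hasLaw_corner_normSq (by positivity) (by positivity) hc hv hvi hcv
  have hne : ∀ᵐ ω ∂P, ∀ j, v j ω ≠ 0 :=
    MeasureTheory.ae_all_iff.2 fun j => ae_ne_zero_of_hasLaw_complexNormal (by positivity) (hv j)
  have h := hasLaw_of_injOn_of_hasFDerivWithinAt
    (Y := fun ω => borderedEigenvalues a (c ω) fun j => v j ω) measurableSet_interlaces
    (fun l _ => (hasFDerivAt_borderData a l).hasFDerivWithinAt) (injOn_borderData ha.injective) hX
    (hne.mono fun ω hω => interlaces_borderedEigenvalues ha (c ω) hω)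
    (.of_forall fun ω => borderData_borderedEigenvalues ha.injective (c ω) _)
  convert h using 2
  funext l
  by_cases hl : Interlaces l a
  · rw [Set.indicator_of_mem (by exact hl), hdet, abs_det_mul_cornerDensity hσ ha hl]
  · rw [Set.indicator_of_notMem (by exact hl), borderedDensity,
      Set.indicator_of_notMem (by exact hl), ENNReal.ofReal_zero]
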